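/- Let $(R,\mathfrak m)$ be a noetherian local ring and let $\mathfrak q\subseteq\mathfrak m$ be an ideal with $\mathfrak m^2=\mathfrak q\mathfrak m$ and $\mathfrak q^2=0$. (1) Let $y_1,\dots,y_e$ be a minimal generating set of $\mathfrak q$. Then the collection of ideals $$\mathcal F=\{0,(y_1),(y_1,y_2),\dots,(y_1,\dots,y_{e-1})\}\ \cup\ \{I\subseteq\mathfrak m : I \text{ is an ideal containing } \mathfrak q\}$$ is a Koszul filtration of $R$, i.e. - $0\in\mathcal F$ and $\mathfrak m\in\mathcal F$; - $I\cap\mathfrak m^{s+1}=\mathfrak m^sI$ for all $I\in\mathcal F$ and all $s\ge 1$; - for every $I\ne 0$ in $\mathcal F$ there are a finite chain $0=I_0\subsetneq I_1\subsetneq\dots\subsetneq I_n=I$ and elements $x_j\in I_j\setminus I_{j-1}$ such that, for $j=1,\dots,n$, $I_j\in\mathcal F$, $I_j=I_{j-1}+(x_j)$ and $I_{j-1}:x_j\in\mathcal F$. (2) Every finitely generated $R$-module $M$ with $\mathfrak q M=0$ is a Koszul module, i.e. has linearity defect $0$. Here the linearity defect of a finitely generated $R$-module $M$ is $\sup\{i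 : H_i(\operatorname{lin}^R F)\neq 0\}$ (and $0$ if $M=0$), where $F$ is the minimal free resolution of $M$ and its linear part $\operatorname{lin}^R F$ is the associated graded complex of $F$ for the filtration $(\mathcal G^nF)_i=\mathfrak m^{n-i}F_i$, with $\mathfrak m^j=R$ for $j\le 0$. -/

import Mathlib

open IsLocalRing CategoryTheory

universe u v

/-- A minimal free resolution
`⋯ ⟶ R ^ rank 2 ⟶ R ^ rank 1 ⟶ R ^ rank 0 ⟶ M ⟶ 0`
of a module `M` over a local ring `R` with maximal ideal `𝔪`: an exact complex of finite free
modules whose differentials map `F_{i+1}` into `𝔪 F_i`. -/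
structure MinimalFreeResolution (R : Type u) [CommRing R] [IsLocalRing R]
    (M : Type v) [AddCommGroup M] [Module R M] where
  /-- the rank of the free module in degree `i` -/
  rank : ℕ → ℕ
  /-- the differential `F_{i+1} ⟶ F_i` -/
  d : ∀ i : ℕ, (Fin (rank (i + 1)) → R) →ₗ[R] (Fin (rank i) → R)
  /-- the augmentation `F_0 ⟶ M` -/
  ε : (Fin (rank 0) → R) →ₗ[R] M
  surjective_ε : Function.Surjective ε
  exact_ε : Function.Exact (d 0) ε
  exact_d : ∀ i : ℕ, Function.Exact (d (i + 1)) (d i)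
  minimal : ∀ i : ℕ, LinearMap.range (d i) ≤
    maximalIdeal R • (⊤ : Submodule R (Fin (rank i) → R))

namespace MinimalFreeResolution

section LinearPart

variable {R : Type u} [CommRing R] [IsLocalRing R] {M : Type v} [AddCommGroup M] [Module R M]
  (F : MinimalFreeResolution R M)

/-- The filtration `(𝒢ⁿ F)_i = 𝔪 ^ (n - i) F_i`. The truncated subtraction of natural numbers
encodes the convention `𝔪 ^ j = R` for `j ≤ 0`. -/
def filtration (n i : ℕ) : Submodule R (Fin (F.rank i) → R) :=
  maximalIdeal R ^ (n - i) • (⊤ : Submodule R (Fin (F.rank i) → R))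

theorem d_mem_filtration (n n' i : ℕ) (h : n ≤ n') (x : Fin (F.rank (i + 1)) → R)
    (hx : x ∈ F.filtration n' (i + 1)) : F.d i x ∈ F.filtration n i := by
  have h1 : Submodule.map (F.d i) (F.filtration n' (i + 1)) ≤ F.filtration n i := by
    unfold filtration
    rw [Submodule.map_smul'', Submodule.map_top]
    refine (smul_mono_right _ (F.minimal i)).trans ?_
    rw [← Submodule.mul_smul, ← pow_succ]
    exact Submodule.smul_mono_left (Ideal.pow_le_pow_right (by omega))
  exact h1 (Submodule.mem_map_of_mem hx)

/-- The graded piece `(𝒢ⁿ F)_i / (𝒢ⁿ⁺¹ F)_i`. -/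
def gr (n i : ℕ) : Type u :=
  F.filtration n i ⧸ (F.filtration (n + 1) i).submoduleOf (F.filtration n i)

instance (n i : ℕ) : AddCommGroup (F.gr n i) :=
  inferInstanceAs (AddCommGroup
    (F.filtration n i ⧸ (F.filtration (n + 1) i).submoduleOf (F.filtration n i)))

instance (n i : ℕ) : Module R (F.gr n i) :=
  inferInstanceAs (Module R
    (F.filtration n i ⧸ (F.filtration (n + 1) i).submoduleOf (F.filtration n i)))

/-- The map `(𝒢ⁿ F)_{i+1} / (𝒢ⁿ⁺¹ F)_{i+1} ⟶ (𝒢ⁿ F)_i / (𝒢ⁿ⁺¹ F)_i` induced by the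
differential. -/
def grD (n i : ℕ) : F.gr n (i + 1) →ₗ[R] F.gr n i :=
  Submodule.mapQ _ _
    ((F.d i).restrict (fun x hx => F.d_mem_filtration n n i le_rfl x hx))
    (fun x hx => F.d_mem_filtration (n + 1) (n + 1) i le_rfl x.1 hx)

theorem grD_grD (n i : ℕ) (x : F.gr n (i + 1 + 1)) : F.grD n i (F.grD n (i + 1) x) = 0 := by
  obtain ⟨x, rfl⟩ := Submodule.Quotient.mk_surjective _ x
  have h : F.d i (F.d (i + 1) x.1) = 0 := (F.exact_d i).apply_apply_eq_zero x.1
  refine (Submodule.Quotient.mk_eq_zero _).2 ?_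
  change F.d i (F.d (i + 1) x.1) ∈ F.filtration (n + 1) i
  rw [h]
  exact Submodule.zero_mem _

/-- The linear part of `F`: the associated graded complex
`⨁ₙ (𝒢ⁿ F) / (𝒢ⁿ⁺¹ F)` of the filtration `𝒢`, with the differential induced by that of `F`. -/
noncomputable def linearPart : ChainComplex (ModuleCat.{u} R) ℕ :=
  ChainComplex.of
    (fun i => ModuleCat.of R (DirectSum ℕ (fun n => F.gr n i)))
    (fun i => ModuleCat.ofHom (DirectSum.lmap (fun n => F.grD n i)))
    (fun i => ModuleCat.hom_ext (LinearMap.ext fun x =>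
      DFinsupp.ext (β := fun n => F.gr n i) fun n => F.grD_grD n i (x n)))

end LinearPart

section Existence

variable {R : Type u} [CommRing R] [IsLocalRing R]

/-- A finitely generated module over a local ring has a free cover `R ^ n ⟶ M` whose kernel lies
in `𝔪 R ^ n`. -/
theorem exists_cover (R : Type u) [CommRing R] [IsLocalRing R]
    (M : Type v) [AddCommGroup M] [Module R M] [Module.Finite R M] :
    ∃ (n : ℕ) (f : (Fin n → R) →ₗ[R] M), Function.Surjective f ∧
      LinearMap.ker f ≤ maximalIdeal R • (⊤ : Submodule R (Fin n → R)) := by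
  classical
  have hex : ∃ n : ℕ, ∃ v : Fin n → M, Submodule.span R (Set.range v) = ⊤ :=
    Module.Finite.exists_fin
  obtain ⟨v, hv⟩ := Nat.find_spec hex
  have hmin := fun m (hm : m < Nat.find hex) => Nat.find_min hex hm
  generalize Nat.find hex = n at v hv hmin
  refine ⟨n, Fintype.linearCombination R v, ?_, ?_⟩
  · rw [← LinearMap.range_eq_top, Fintype.range_linearCombination, hv]
  · intro x hx
    have hx0 : ∑ i, x i • v i = 0 := by
      simpa [Fintype.linearCombination_apply] using hx
    have hmem : ∀ j, x j ∈ maximalIdeal R := by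
      intro j
      by_contra hj
      have hu : IsUnit (x j) := by
        simpa [mem_maximalIdeal, mem_nonunits_iff] using hj
      obtain ⟨c, hc⟩ := hu.exists_left_inv
      obtain ⟨k, rfl⟩ : ∃ k, n = k + 1 := ⟨n - 1, by have := j.2; omega⟩
      refine hmin k (Nat.lt_succ_self k) ⟨v ∘ j.succAbove, ?_⟩
      rw [eq_top_iff, ← hv, Submodule.span_le]
      have hs : ∀ i : Fin k, v (j.succAbove i) ∈
          Submodule.span R (Set.range (v ∘ j.succAbove)) :=
        fun i => Submodule.subset_span ⟨i, rfl⟩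
      rintro _ ⟨i, rfl⟩
      rcases Fin.eq_self_or_eq_succAbove j i with h | ⟨i', rfl⟩
      · subst h
        rw [Fin.sum_univ_succAbove _ i] at hx0
        have h1 : v i = -(c • ∑ l, x (i.succAbove l) • v (i.succAbove l)) := by
          rw [← eq_neg_iff_add_eq_zero] at hx0
          rw [← smul_neg, ← hx0, smul_smul, hc, one_smul]
        rw [h1]
        exact Submodule.neg_mem _ (Submodule.smul_mem _ _
          (Submodule.sum_mem _ fun l _ => Submodule.smul_mem _ _ (hs l)))
      · exact hs i'
    have hx1 : x = ∑ i, x i • (Pi.single i (1 : R) : Fin n → R) := pi_eq_sum_univ' x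
    rw [hx1]
    exact Submodule.sum_mem _ fun i _ => Submodule.smul_mem_smul (hmem i) Submodule.mem_top

/-- Every finitely generated module over a noetherian local ring has a minimal free resolution. -/
theorem nonempty (R : Type u) [CommRing R] [IsLocalRing R] [IsNoetherianRing R]
    (M : Type v) [AddCommGroup M] [Module R M] [Module.Finite R M] :
    Nonempty (MinimalFreeResolution R M) := by
  obtain ⟨n₀, f₀, hf₀, hk₀⟩ := exists_cover R M
  have hstep : ∀ s : (Σ n : ℕ, Submodule R (Fin n → R)), ∃ (n : ℕ) (f : (Fin n → R) →ₗ[R] s.2),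
      Function.Surjective f ∧
      LinearMap.ker f ≤ maximalIdeal R • (⊤ : Submodule R (Fin n → R)) :=
    fun s => exists_cover R s.2
  choose N f hf hk using hstep
  let S : ℕ → (Σ n : ℕ, Submodule R (Fin n → R)) := fun i =>
    Nat.rec ⟨n₀, LinearMap.ker f₀⟩ (fun _ s => ⟨N s, LinearMap.ker (f s)⟩) i
  let D : ∀ i : ℕ, (Fin (S (i + 1)).1 → R) →ₗ[R] (Fin (S i).1 → R) :=
    fun i => (S i).2.subtype.comp (f (S i))
  have hrange : ∀ i, LinearMap.range (D i) = (S i).2 := by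
    intro i
    have h : LinearMap.range (f (S i)) = ⊤ := LinearMap.range_eq_top.2 (hf (S i))
    change LinearMap.range ((S i).2.subtype.comp (f (S i))) = (S i).2
    rw [LinearMap.range_comp, h, Submodule.map_top, Submodule.range_subtype]
  have hker : ∀ i, LinearMap.ker (D i) = (S (i + 1)).2 := by
    intro i
    change LinearMap.ker ((S i).2.subtype.comp (f (S i))) = LinearMap.ker (f (S i))
    rw [LinearMap.ker_comp, Submodule.ker_subtype, Submodule.comap_bot]
  refine ⟨⟨fun i => (S i).1, D, f₀, hf₀, ?_, ?_, ?_⟩⟩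
  · exact LinearMap.exact_iff.2 (hrange 0).symm
  · exact fun i => LinearMap.exact_iff.2 ((hker i).trans (hrange (i + 1)).symm)
  · intro i
    refine (hrange i).le.trans ?_
    cases i with
    | zero => exact hk₀
    | succ i => exact hk (S i)

end Existence

end MinimalFreeResolution

/-- The linearity defect `sup {i : H_i (linear part of F) ≠ 0}` of `M`, where `F` is the minimal
free resolution of `M`; it is a value in `ℕ ∪ {∞}`, and the supremum of the empty set is `0`, so
that the zero module has linearity defect `0`. As the minimal free resolution exists and is unique
up to isomorphism, the supremum over all minimal free resolutions `F` is the value at any one. -/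
noncomputable def linearityDefect (R : Type u) [CommRing R] [IsLocalRing R] [IsNoetherianRing R]
    (M : Type v) [AddCommGroup M] [Module R M] [Module.Finite R M] : ℕ∞ :=
  ⨆ F : MinimalFreeResolution R M,
    sSup {t : ℕ∞ | ∃ i : ℕ, t = i ∧ ¬ Limits.IsZero (F.linearPart.homology i)}

/-- A finitely generated module over a noetherian local ring is a Koszul module if its linearity
defect is `0`. -/
def IsKoszulModule (R : Type u) [CommRing R] [IsLocalRing R] [IsNoetherianRing R]
    (M : Type v) [AddCommGroup M] [Module R M] [Module.Finite R M] : Prop :=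
  linearityDefect R M = 0

/-- A collection `𝓕` of ideals of a local ring `R` with maximal ideal `𝔪` is a Koszul
filtration. -/
structure IsKoszulFiltration {R : Type u} [CommRing R] [IsLocalRing R]
    (𝓕 : Set (Ideal R)) : Prop where
  bot_mem : ⊥ ∈ 𝓕
  maximalIdeal_mem : maximalIdeal R ∈ 𝓕
  inf_pow : ∀ I ∈ 𝓕, ∀ s : ℕ, 1 ≤ s → I ⊓ maximalIdeal R ^ (s + 1) = maximalIdeal R ^ s * I
  /-- Every nonzero `I` in `𝓕` has a finite chain `0 = J 0 ⊂ J 1 ⊂ ⋯ ⊂ J n = I` of members of `𝓕`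
  with `J (j + 1) = J j + (x j)`, `x j ∉ J j` and `J j : x j` in `𝓕`. -/
  exists_chain : ∀ I ∈ 𝓕, I ≠ ⊥ → ∃ (n : ℕ) (J : ℕ → Ideal R) (x : ℕ → R),
    J 0 = ⊥ ∧ J n = I ∧ ∀ j < n,
      J j < J (j + 1) ∧ x j ∈ J (j + 1) ∧ x j ∉ J j ∧ J (j + 1) ∈ 𝓕 ∧
      J (j + 1) = J j ⊔ Ideal.span {x j} ∧ (J j).colon {x j} ∈ 𝓕

/-- `y_1, …, y_e` is a minimal generating set of the ideal `q`: it generates `q`, and no `y_i` can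
be left out. -/
def IsMinimalGeneratingFamily {R : Type u} [CommRing R] (q : Ideal R) {e : ℕ} (y : Fin e → R) :
    Prop :=
  Ideal.span (Set.range y) = q ∧ ∀ i : Fin e, Ideal.span (y '' {j | j ≠ i}) ≠ q

/-- The collection
`{0, (y_1), (y_1, y_2), …, (y_1, …, y_{e-1})} ∪ {I : q ⊆ I ⊆ 𝔪}` of ideals. -/
def chainAndIdealsContaining {R : Type u} [CommRing R] [IsLocalRing R] (q : Ideal R) {e : ℕ}
    (y : Fin e → R) : Set (Ideal R) :=
  {I | I = ⊥ ∨ ∃ i : ℕ, 1 ≤ i ∧ i < e ∧ I = Ideal.span (y '' {j | (j : ℕ) < i})} ∪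
    {I | q ≤ I ∧ I ≤ maximalIdeal R}

/-! The hypotheses give `𝔪³ = q²𝔪 = 0`, so only finitely many powers matter. Filtration: every colon
ideal in a chain is proper and contains `q`, below `q` because `q² = 0` and above `q` trivially, so
it lies in the collection. The condition on `I ∩ 𝔪^(s+1)` matters only for `s = 1`. It is immediate
when `q ⊆ I`. For a prefix it says that a combination of minimal generators lying in `𝔪q` has
coefficients in `𝔪`, which is Nakayama (`coeff_mem`).

Koszul modules: for a minimal cover `F ⟶ N` with kernel `Z`, the key property is `Z ∩ 𝔪²F ⊆ 𝔪Z`. If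
`qN = 0`, then `qF ⊆ Z` and `𝔪²F = 𝔪qF`, which gives it at once. But `Z` need not be killed by `q`;
it is an extension of `Z/qF` by `qF`, both killed by `q`, with `qF ∩ 𝔪Z = 𝔪qF`. The class of
iterated extensions of this kind is closed under syzygies, and the property holds throughout it, by
a horseshoe argument (`exists_isLinearCover_of_extension`). Hence it holds at every stage of the
minimal resolution, and with `𝔪³ = 0` it makes the linear part exact in positive degrees. -/

/-! ### The Koszul filtration. -/

section KoszulFiltration

variable {R : Type u} [CommRing R]

/-- `J` is obtained from `I` by one step of a chain in a Koszul filtration `𝓕`. -/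
def KoszulStep (𝓕 : Set (Ideal R)) (I J : Ideal R) : Prop :=
  I < J ∧ J ∈ 𝓕 ∧ ∃ x ∈ J, x ∉ I ∧ J = I ⊔ Ideal.span {x} ∧ I.colon {x} ∈ 𝓕

theorem koszulStep_of_notMem {𝓕 : Set (Ideal R)} {I : Ideal R} {x : R} (hx : x ∉ I)
    (hJ : I ⊔ Ideal.span {x} ∈ 𝓕) (hc : I.colon {x} ∈ 𝓕) :
    KoszulStep 𝓕 I (I ⊔ Ideal.span {x}) := by
  have hxJ : x ∈ I ⊔ Ideal.span {x} := Ideal.mem_sup_right (Ideal.mem_span_singleton_self x)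
  exact ⟨lt_of_le_not_ge le_sup_left fun h => hx (h hxJ), hJ, x, hxJ, hx, rfl, hc⟩

/-- Lets chains be built by reachability and converted to indexed sequences only once; values beyond
the length are arbitrary. -/
theorem exists_chain_of_reflTransGen {𝓕 : Set (Ideal R)} {I : Ideal R}
    (h : Relation.ReflTransGen (KoszulStep 𝓕) ⊥ I) :
    ∃ (n : ℕ) (J : ℕ → Ideal R) (x : ℕ → R),
      J 0 = ⊥ ∧ J n = I ∧ ∀ j < n,
        J j < J (j + 1) ∧ x j ∈ J (j + 1) ∧ x j ∉ J j ∧ J (j + 1) ∈ 𝓕 ∧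
        J (j + 1) = J j ⊔ Ideal.span {x j} ∧ (J j).colon {x j} ∈ 𝓕 := by
  induction h with
  | refl => exact ⟨0, fun _ => ⊥, fun _ => 0, rfl, rfl, fun j hj => absurd hj (by omega)⟩
  | @tail I' I'' _ hs ih =>
    obtain ⟨n, J, x, h0, hn, hc⟩ := ih
    obtain ⟨hlt, hmem, z, hz, hz', hsup, hcol⟩ := hs
    refine ⟨n + 1, fun j => if j ≤ n then J j else I'', fun j => if j < n then x j else z,
      by simpa using h0, by simp, fun j hj => ?_⟩
    rcases Nat.lt_succ_iff_lt_or_eq.1 hj with hj' | rfl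
    · simpa [hj', hj'.le, Nat.succ_le_of_lt hj'] using hc j hj'
    · simp only [le_refl, if_true, lt_irrefl, if_false, Nat.not_succ_le_self, hn]
      exact ⟨hlt, hz, hz', hmem, hsup, hcol⟩

theorem maximalIdeal_pow_three_eq_bot [IsLocalRing R] {q : Ideal R}
    (hm : maximalIdeal R ^ 2 = q * maximalIdeal R) (hq : q ^ 2 = ⊥) : maximalIdeal R ^ 3 = ⊥ := by
  rw [pow_succ, hm, mul_assoc, ← sq, hm, ← mul_assoc, ← sq, hq, Ideal.bot_mul]

theorem maximalIdeal_mul_eq_sq [IsLocalRing R] {q I : Ideal R} (hm : maximalIdeal R ^ 2 = q * maximalIdeal R)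
    (hqI : q ≤ I) (hI : I ≤ maximalIdeal R) : maximalIdeal R * I = maximalIdeal R ^ 2 := by
  refine le_antisymm ((Ideal.mul_mono_right hI).trans (sq _).ge) ?_
  rw [hm, mul_comm]
  exact Ideal.mul_mono_right hqI

theorem colon_singleton_le_maximalIdeal [IsLocalRing R] {I : Ideal R} {x : R} (hx : x ∉ I) :
    I.colon {x} ≤ maximalIdeal R := by
  refine le_maximalIdeal fun h => hx ?_
  have h1 : (1 : R) ∈ I.colon {x} := h ▸ Submodule.mem_top
  simpa using Submodule.mem_colon_singleton.1 h1

/-- The ideal generated by the first `i` members of `y`. -/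
def spanPrefix {e : ℕ} (y : Fin e → R) (i : ℕ) : Ideal R :=
  Ideal.span (y '' {j | (j : ℕ) < i})

namespace IsMinimalGeneratingFamily

variable {q : Ideal R} {e : ℕ} {y : Fin e → R}

theorem mem (hy : IsMinimalGeneratingFamily q y) (i : Fin e) : y i ∈ q :=
  hy.1 ▸ Ideal.subset_span ⟨i, rfl⟩

theorem spanPrefix_le (hy : IsMinimalGeneratingFamily q y) (i : ℕ) : spanPrefix y i ≤ q :=
  Ideal.span_le.2 (by rintro _ ⟨j, -, rfl⟩; exact hy.mem j)

theorem le_span_of_mem (hy : IsMinimalGeneratingFamily q y) {J : Ideal R} {i : Fin e}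
    (hJ : Ideal.span (y '' {j | j ≠ i}) ≤ J) (hi : y i ∈ J) : q ≤ J := by
  rw [← hy.1, Ideal.span_le]
  rintro _ ⟨j, rfl⟩
  by_cases hj : j = i
  · exact hj ▸ hi
  · exact hJ (Ideal.subset_span ⟨j, hj, rfl⟩)

theorem span_ne_le (hy : IsMinimalGeneratingFamily q y) (i : Fin e) :
    Ideal.span (y '' {j | j ≠ i}) ≤ q :=
  Ideal.span_le.2 (by rintro _ ⟨j, -, rfl⟩; exact hy.mem j)

theorem notMem_spanPrefix (hy : IsMinimalGeneratingFamily q y) (i : Fin e) :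
    y i ∉ spanPrefix y i := fun h =>
  hy.2 i (le_antisymm (hy.span_ne_le i) (hy.le_span_of_mem le_rfl
    (Ideal.span_mono (Set.image_mono fun _ hj => Fin.ne_of_lt hj) h)))

/-- A unit coefficient would put `y i` in the span of the other generators plus `𝔪q`, and Nakayama
would make `y i` redundant. -/
theorem coeff_mem [IsLocalRing R] (hy : IsMinimalGeneratingFamily q y) (hqfg : q.FG) {l : Fin e →₀ R}
    (hl : Finsupp.linearCombination R y l ∈ maximalIdeal R * q) (i : Fin e) :
    l i ∈ maximalIdeal R := by
  by_contra hi
  obtain ⟨c, hc⟩ : ∃ c, c * l i = 1 := by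
    have hu : IsUnit (l i) := by simpa [mem_maximalIdeal, mem_nonunits_iff] using hi
    exact hu.exists_left_inv
  refine hy.2 i (le_antisymm (hy.span_ne_le i) ?_)
  refine Submodule.le_of_le_smul_of_le_jacobson_bot (I := maximalIdeal R) hqfg
    (maximalIdeal_le_jacobson _) (hy.le_span_of_mem le_sup_left ?_)
  rw [Finsupp.linearCombination_apply, Finsupp.sum_fintype _ _ (by simp),
    ← Finset.add_sum_erase _ _ (Finset.mem_univ i)] at hl
  set s := ∑ j ∈ Finset.univ.erase i, l j • y j
  have hs : s ∈ Ideal.span (y '' {j | j ≠ i}) := Submodule.sum_mem _ fun j hj =>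
    Submodule.smul_mem _ _ (Ideal.subset_span ⟨j, Finset.ne_of_mem_erase hj, rfl⟩)
  have hyi : y i = -(c * s) + c * (l i • y i + s) := by
    rw [smul_eq_mul, mul_add, ← mul_assoc, hc]; ring
  rw [hyi]
  exact Submodule.add_mem_sup (Submodule.neg_mem _ (Ideal.mul_mem_left _ _ hs))
    (Ideal.mul_mem_left _ _ hl)

theorem spanPrefix_inf_le [IsLocalRing R] (hy : IsMinimalGeneratingFamily q y) (hqfg : q.FG) (i : ℕ) :
    spanPrefix y i ⊓ maximalIdeal R * q ≤ maximalIdeal R * spanPrefix y i := by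
  rintro x ⟨hx, hxm⟩
  obtain ⟨l, hl, rfl⟩ := (Finsupp.mem_span_image_iff_linearCombination R).1 hx
  have hlm := hy.coeff_mem hqfg hxm
  rw [Finsupp.linearCombination_apply]
  exact Submodule.sum_mem _ fun j hj => Ideal.mul_mem_mul (hlm j)
    (Ideal.subset_span ⟨j, hl hj, rfl⟩)

end IsMinimalGeneratingFamily

theorem spanPrefix_zero {e : ℕ} (y : Fin e → R) : spanPrefix y 0 = ⊥ := by simp [spanPrefix]

theorem spanPrefix_length {e : ℕ} (y : Fin e → R) : spanPrefix y e = Ideal.span (Set.range y) := by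
  simp [spanPrefix]

theorem spanPrefix_succ {e : ℕ} (y : Fin e → R) (i : Fin e) :
    spanPrefix y (i + 1) = spanPrefix y i ⊔ Ideal.span {y i} := by
  rw [spanPrefix, spanPrefix, ← Ideal.span_union, ← Set.image_singleton, ← Set.image_union]
  congr 2
  ext j
  simp only [Set.mem_ofPred_eq, Set.mem_union, Set.mem_singleton_iff, Fin.ext_iff]
  omega

theorem IsMinimalGeneratingFamily.isKoszulFiltration [IsLocalRing R] [IsNoetherianRing R]
    {q : Ideal R}
    (hqm : q ≤ maximalIdeal R) (hm : maximalIdeal R ^ 2 = q * maximalIdeal R) (hq : q ^ 2 = ⊥)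
    {e : ℕ} {y : Fin e → R} (hy : IsMinimalGeneratingFamily q y) :
    IsKoszulFiltration (chainAndIdealsContaining q y) := by
  have hpre : ∀ i ≤ e, spanPrefix y i ∈ chainAndIdealsContaining q y := by
    intro i hi
    rcases Nat.eq_zero_or_pos i with rfl | h0
    · exact Or.inl (Or.inl (spanPrefix_zero y))
    rcases hi.eq_or_lt with rfl | he
    · rw [spanPrefix_length, hy.1]
      exact Or.inr ⟨le_rfl, hqm⟩
    · exact Or.inl (Or.inr ⟨i, h0, he, rfl⟩)
  have hcases : ∀ I ∈ chainAndIdealsContaining q y,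
      (∃ i ≤ e, I = spanPrefix y i) ∨ (q ≤ I ∧ I ≤ maximalIdeal R) := by
    rintro I ((rfl | ⟨i, -, hi, rfl⟩) | hI)
    · exact Or.inl ⟨0, Nat.zero_le _, (spanPrefix_zero y).symm⟩
    · exact Or.inl ⟨i, hi.le, rfl⟩
    · exact Or.inr hI
  have hpath : ∀ i ≤ e, Relation.ReflTransGen (KoszulStep (chainAndIdealsContaining q y)) ⊥
      (spanPrefix y i) := by
    intro i
    induction i with
    | zero => intro _; rw [spanPrefix_zero]
    | succ i ih =>
      intro hi
      refine (ih (by omega)).tail ?_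
      have hs := spanPrefix_succ y ⟨i, hi⟩
      rw [show spanPrefix y (i + 1) = _ from hs]
      have hn : y ⟨i, hi⟩ ∉ spanPrefix y i := hy.notMem_spanPrefix ⟨i, hi⟩
      refine koszulStep_of_notMem hn (hs ▸ hpre _ hi)
        (Or.inr ⟨fun r hr => ?_, colon_singleton_le_maximalIdeal hn⟩)
      -- The colon contains `q` because `q² = 0`.
      have h0 : r * y ⟨i, hi⟩ ∈ q ^ 2 := sq q ▸ Ideal.mul_mem_mul hr (hy.mem _)
      rw [hq, Ideal.mem_bot] at h0
      rw [Submodule.mem_colon_singleton, smul_eq_mul, h0]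
      exact Submodule.zero_mem _
  have hpathq : Relation.ReflTransGen (KoszulStep (chainAndIdealsContaining q y)) ⊥ q := by
    have h := hpath e le_rfl
    rwa [spanPrefix_length, hy.1] at h
  refine ⟨Or.inl (Or.inl rfl), Or.inr ⟨hqm, le_rfl⟩, ?_, ?_⟩
  · intro I hI s hs
    have hIm : I ≤ maximalIdeal R := by
      rcases hcases I hI with ⟨i, -, rfl⟩ | h
      exacts [(hy.spanPrefix_le i).trans hqm, h.2]
    refine le_antisymm ?_ (le_inf Ideal.mul_le_right ?_)
    · rcases hs.eq_or_lt with rfl | hs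
      · rw [pow_one]
        rcases hcases I hI with ⟨i, -, rfl⟩ | ⟨h1, h2⟩
        · rw [hm, mul_comm q]
          exact hy.spanPrefix_inf_le (IsNoetherian.noetherian q) i
        · rw [maximalIdeal_mul_eq_sq hm h1 h2]
          exact inf_le_right
      -- For `s ≥ 2` the left side lies in `𝔪³ = 0`.
      · have h0 : maximalIdeal R ^ (s + 1) ≤ ⊥ :=
          (Ideal.pow_le_pow_right (by omega)).trans (maximalIdeal_pow_three_eq_bot hm hq).le
        exact inf_le_right.trans (h0.trans bot_le)
    · rw [pow_succ]
      exact Ideal.mul_mono_right hIm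
  · intro I hI _
    apply exists_chain_of_reflTransGen
    rcases hcases I hI with ⟨i, hi, rfl⟩ | ⟨hqI, hIm⟩
    · exact hpath i hi
    -- Take a maximal reachable ideal between `q` and `I`; if it were not `I`, adjoining any further
    -- element of `I` would be another legal step.
    · obtain ⟨K, ⟨hqK, hKI, hK⟩, hmax⟩ := set_has_maximal_iff_noetherian.2
        (inferInstance : IsNoetherian R R)
        {K : Ideal R | q ≤ K ∧ K ≤ I ∧
          Relation.ReflTransGen (KoszulStep (chainAndIdealsContaining q y)) ⊥ K}
        ⟨q, le_rfl, hqI, hpathq⟩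
      rcases hKI.eq_or_lt with rfl | hlt
      · exact hK
      obtain ⟨x, hxI, hxK⟩ := SetLike.exists_of_lt hlt
      have hle : K ⊔ Ideal.span {x} ≤ I :=
        sup_le hKI ((Ideal.span_singleton_le_iff_mem _).2 hxI)
      have hstep : KoszulStep (chainAndIdealsContaining q y) K (K ⊔ Ideal.span {x}) :=
        koszulStep_of_notMem hxK (Or.inr ⟨hqK.trans le_sup_left, hle.trans hIm⟩)
          (Or.inr ⟨fun r hr => Submodule.mem_colon_singleton.2
            (Ideal.mul_mem_right _ _ (hqK hr)), colon_singleton_le_maximalIdeal hxK⟩)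
      exact absurd hstep.1 (hmax _ ⟨hqK.trans le_sup_left, hle, hK.tail hstep⟩)

end KoszulFiltration

/-! ### Syzygies of iterated pure extensions. -/

section LinearCovers

variable {R : Type u} [CommRing R]

theorem Submodule.mem_smul_top_prod_iff {I : Ideal R} {A B : Type*} [AddCommGroup A] [Module R A]
    [AddCommGroup B] [Module R B] {z : A × B} :
    z ∈ I • (⊤ : Submodule R (A × B)) ↔
      z.1 ∈ I • (⊤ : Submodule R A) ∧ z.2 ∈ I • (⊤ : Submodule R B) := by
  refine ⟨fun h => ⟨Submodule.smul_top_le_comap_smul_top I (LinearMap.fst R A B) h,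
    Submodule.smul_top_le_comap_smul_top I (LinearMap.snd R A B) h⟩, fun ⟨h1, h2⟩ => ?_⟩
  have hz : z = LinearMap.inl R A B z.1 + LinearMap.inr R A B z.2 := by ext <;> simp
  rw [hz]
  exact Submodule.add_mem _ (Submodule.smul_top_le_comap_smul_top I (LinearMap.inl R A B) h1)
    (Submodule.smul_top_le_comap_smul_top I (LinearMap.inr R A B) h2)

/-- The modules obtained by iterated extensions `0 ⟶ A ⟶ N ⟶ B ⟶ 0` with `A ∩ I N = I A` from the
finitely generated modules annihilated by `q`. -/
inductive IsIteratedPureExtension (I q : Ideal R) :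
    ∀ (N : Type u) [AddCommGroup N] [Module R N], Prop
  | of_annihilated (N : Type u) [AddCommGroup N] [Module R N] [Module.Finite R N]
      (h : ∀ r ∈ q, ∀ x : N, r • x = 0) : IsIteratedPureExtension I q N
  | extension (A N B : Type u) [AddCommGroup A] [Module R A] [AddCommGroup N] [Module R N]
      [AddCommGroup B] [Module R B] (f : A →ₗ[R] N) (g : N →ₗ[R] B)
      (hf : Function.Injective f) (hfg : Function.Exact f g) (hg : Function.Surjective g)
      (hpure : ∀ a, f a ∈ I • (⊤ : Submodule R N) → a ∈ I • (⊤ : Submodule R A))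
      (hA : IsIteratedPureExtension I q A) (hB : IsIteratedPureExtension I q B) :
      IsIteratedPureExtension I q N

namespace IsIteratedPureExtension

variable {I q : Ideal R}

theorem finite {N : Type u} [AddCommGroup N] [Module R N]
    (h : IsIteratedPureExtension I q N) : Module.Finite R N := by
  induction h with
  | of_annihilated => assumption
  | extension A N B f g hf hfg hg _ _ _ hA hB =>
    exact Module.Finite.of_exact hfg hg

theorem of_equiv {N N' : Type u} [AddCommGroup N] [Module R N] [AddCommGroup N'] [Module R N']
    (h : IsIteratedPureExtension I q N) (e : N ≃ₗ[R] N') : IsIteratedPureExtension I q N' := by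
  cases h with
  | of_annihilated _ h =>
    have : Module.Finite R N' := Module.Finite.equiv e
    refine of_annihilated N' fun r hr x => ?_
    rw [← e.apply_symm_apply x, ← map_smul, h r hr, map_zero]
  | extension A _ B f g hf hfg hg hpure hA hB =>
    refine extension A N' B (e.toLinearMap ∘ₗ f) (g ∘ₗ e.symm.toLinearMap) (e.injective.comp hf)
      (fun x => ?_) (hg.comp e.symm.surjective) (fun a ha => hpure a ?_) hA hB
    · simp only [LinearMap.comp_apply, LinearEquiv.coe_coe, Set.mem_range]
      rw [hfg (e.symm x)]
      simp only [Set.mem_range, LinearEquiv.eq_symm_apply]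
    · simpa using Submodule.smul_top_le_comap_smul_top I e.symm.toLinearMap ha

end IsIteratedPureExtension

variable [IsLocalRing R]

/-- A surjection `F ⟶ N` with kernel in `𝔪 F`. -/
structure IsMinimalCover {F N : Type*} [AddCommGroup F] [Module R F] [AddCommGroup N] [Module R N]
    (f : F →ₗ[R] N) : Prop where
  surjective : Function.Surjective f
  ker_le : LinearMap.ker f ≤ maximalIdeal R • (⊤ : Submodule R F)

/-- The kernel `Z` of a linear cover `F ⟶ N` is an iterated pure extension and satisfies
`Z ∩ 𝔪² F ⊆ 𝔪 Z`. -/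
structure IsLinearCover (q : Ideal R) {F : Type u} {N : Type*} [AddCommGroup F] [Module R F]
    [AddCommGroup N] [Module R N] (f : F →ₗ[R] N) : Prop where
  ker : IsIteratedPureExtension (maximalIdeal R) q (LinearMap.ker f)
  inf_le : LinearMap.ker f ⊓ maximalIdeal R ^ 2 • (⊤ : Submodule R F) ≤
    maximalIdeal R • LinearMap.ker f

section

variable {F G N : Type*} [AddCommGroup F] [Module R F] [AddCommGroup G] [Module R G]
  [AddCommGroup N] [Module R N]

theorem IsMinimalCover.mem_smul_top {f : F →ₗ[R] N} (hf : IsMinimalCover f) {x : F}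
    (hx : f x ∈ maximalIdeal R • (⊤ : Submodule R N)) :
    x ∈ maximalIdeal R • (⊤ : Submodule R F) := by
  rw [← LinearMap.range_eq_top.2 hf.surjective, ← Submodule.map_top, ← Submodule.map_smul''] at hx
  obtain ⟨x', hx', h⟩ := hx
  rw [← sub_add_cancel x x']
  exact Submodule.add_mem _ (hf.ker_le (by rw [LinearMap.mem_ker, map_sub, h, sub_self])) hx'

theorem IsMinimalCover.smul_ker_le {f : F →ₗ[R] N} (hf : IsMinimalCover f) :
    maximalIdeal R • LinearMap.ker f ≤ maximalIdeal R ^ 2 • (⊤ : Submodule R F) := by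
  rw [sq, Submodule.mul_smul]
  exact smul_mono_right _ hf.ker_le

/-- Such a `φ` is the identity modulo `ker g ⊆ 𝔪G`, so Nakayama applies. -/
theorem IsMinimalCover.surjective_of_comp_eq [Module.Finite R G] {g : G →ₗ[R] N}
    (hg : IsMinimalCover g) (φ : G →ₗ[R] G) (h : g ∘ₗ φ = g) : Function.Surjective φ := by
  rw [← LinearMap.range_eq_top, eq_top_iff]
  refine Submodule.le_of_le_smul_of_le_jacobson_bot (I := maximalIdeal R) Module.Finite.fg_top
    (maximalIdeal_le_jacobson _) fun x _ => ?_
  rw [← add_sub_cancel (φ x) x]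
  refine Submodule.add_mem_sup ⟨x, rfl⟩ (hg.ker_le ?_)
  rw [LinearMap.mem_ker, map_sub, ← LinearMap.comp_apply, h, sub_self]

theorem IsMinimalCover.exists_equiv [Module.Finite R F] [Module.Projective R F]
    [Module.Finite R G] [Module.Projective R G] {f : F →ₗ[R] N} {g : G →ₗ[R] N}
    (hf : IsMinimalCover f) (hg : IsMinimalCover g) :
    ∃ e : F ≃ₗ[R] G, g ∘ₗ e.toLinearMap = f := by
  obtain ⟨φ, hφ⟩ := Module.projective_lifting_property g f hg.surjective
  obtain ⟨ψ, hψ⟩ := Module.projective_lifting_property f g hf.surjective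
  have h1 : Function.Surjective (φ ∘ₗ ψ) :=
    hg.surjective_of_comp_eq _ (by rw [← LinearMap.comp_assoc, hφ, hψ])
  have h2 : Function.Surjective (ψ ∘ₗ φ) :=
    hf.surjective_of_comp_eq _ (by rw [← LinearMap.comp_assoc, hψ, hφ])
  have h3 : Function.Injective (ψ ∘ₗ φ) := OrzechProperty.injective_of_surjective_endomorphism _ h2
  exact ⟨LinearEquiv.ofBijective φ ⟨Function.Injective.of_comp h3, Function.Surjective.of_comp h1⟩,
    hφ⟩

end

theorem IsLinearCover.of_equiv {q : Ideal R} {F G : Type u} {N : Type*} [AddCommGroup F]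
    [Module R F] [AddCommGroup G] [Module R G] [AddCommGroup N] [Module R N] {f : F →ₗ[R] N}
    {g : G →ₗ[R] N} (hg : IsLinearCover q g) (e : F ≃ₗ[R] G) (he : g ∘ₗ e.toLinearMap = f) :
    IsLinearCover q f := by
  have hker : (LinearMap.ker g).map e.symm.toLinearMap = LinearMap.ker f := by
    subst he
    rw [Submodule.map_equiv_eq_comap_symm, LinearMap.ker_comp]
    rfl
  refine ⟨hg.ker.of_equiv ((e.symm.submoduleMap _).trans (LinearEquiv.ofEq _ _ hker)), ?_⟩
  rintro x ⟨hx, hx2⟩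
  have hgx : e x ∈ maximalIdeal R • LinearMap.ker g := hg.inf_le
    ⟨by rw [← he] at hx; exact hx, Submodule.smul_top_le_comap_smul_top _ e.toLinearMap hx2⟩
  rw [← hker, ← Submodule.map_smul'']
  exact ⟨e x, hgx, e.symm_apply_apply x⟩

/-- The kernel `Z` is filtered by `qF ⊆ Z`. Both claims rest on `𝔪²F = 𝔪qF`. `M` may live in another
universe than `R`, as the module being resolved does; its syzygies do not. -/
theorem IsMinimalCover.isLinearCover_of_annihilated [IsNoetherianRing R] {q : Ideal R}
    (hm : maximalIdeal R ^ 2 = q * maximalIdeal R) (hq : q ^ 2 = ⊥)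
    {F : Type u} {M : Type v} [AddCommGroup F] [Module R F] [Module.Finite R F]
    [AddCommGroup M] [Module R M] {f : F →ₗ[R] M} (hf : IsMinimalCover f)
    (h : ∀ r ∈ q, ∀ x : M, r • x = 0) : IsLinearCover q f := by
  have hle : q • (⊤ : Submodule R F) ≤ LinearMap.ker f :=
    Submodule.smul_le.2 fun r hr x _ => by rw [LinearMap.mem_ker, map_smul, h r hr]
  have hsq : maximalIdeal R ^ 2 • (⊤ : Submodule R F) = maximalIdeal R • q • ⊤ := by
    rw [hm, mul_comm, Submodule.mul_smul]
  refine ⟨.extension (q • (⊤ : Submodule R F) : Submodule R F) (LinearMap.ker f)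
    (LinearMap.ker f ⧸ (q • (⊤ : Submodule R F)).submoduleOf (LinearMap.ker f))
    (Submodule.inclusion hle) (Submodule.mkQ _) (Submodule.inclusion_injective hle) ?_
    (Submodule.mkQ_surjective _) ?_ (.of_annihilated _ ?_) (.of_annihilated _ ?_), ?_⟩
  · rw [LinearMap.exact_iff, Submodule.ker_mkQ, Submodule.range_inclusion]
    rfl
  -- Purity: `𝔪Z ⊆ 𝔪²F = 𝔪qF`, as `Z ⊆ 𝔪F`.
  · intro a ha
    rw [Submodule.mem_smul_top_iff] at ha ⊢
    rw [← hsq]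
    exact hf.smul_ker_le ha
  · rintro r hr ⟨x, hx⟩
    have h0 : r • x ∈ q • q • (⊤ : Submodule R F) := Submodule.smul_mem_smul hr hx
    rw [← Submodule.mul_smul, ← sq, hq, Submodule.bot_smul] at h0
    exact Subtype.ext h0
  · intro r hr x
    obtain ⟨x, rfl⟩ := Submodule.mkQ_surjective _ x
    rw [← map_smul, Submodule.mkQ_apply, Submodule.Quotient.mk_eq_zero]
    exact Submodule.smul_mem_smul hr Submodule.mem_top
  · rw [hsq]
    exact inf_le_right.trans (smul_mono_right _ hle)

/-- The horseshoe lemma for minimal and linear covers of the ends of a pure extension. -/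
theorem exists_isLinearCover_of_extension {q : Ideal R} {F' F'' A N B : Type u}
    [AddCommGroup F'] [Module R F'] [AddCommGroup F''] [Module R F''] [Module.Projective R F'']
    [AddCommGroup A] [Module R A] [AddCommGroup N] [Module R N] [AddCommGroup B] [Module R B]
    {f : A →ₗ[R] N} {g : N →ₗ[R] B} (hf : Function.Injective f) (hfg : Function.Exact f g)
    (hg : Function.Surjective g)
    (hpure : ∀ a, f a ∈ maximalIdeal R • (⊤ : Submodule R N) →
      a ∈ maximalIdeal R • (⊤ : Submodule R A))
    {p : F' →ₗ[R] A} (hp : IsMinimalCover p) (hpl : IsLinearCover q p)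
    {r : F'' →ₗ[R] B} (hr : IsMinimalCover r) (hrl : IsLinearCover q r) :
    ∃ s : F' × F'' →ₗ[R] N, IsMinimalCover s ∧ IsLinearCover q s := by
  obtain ⟨h, hh⟩ := Module.projective_lifting_property g r hg
  have hgh : ∀ y, g (h y) = r y := fun y => LinearMap.congr_fun hh y
  have hgf : ∀ a, g (f a) = 0 := hfg.apply_apply_eq_zero
  set s : F' × F'' →ₗ[R] N := (f ∘ₗ p).coprod h with hs
  have hsz : ∀ z, s z = f (p z.1) + h z.2 := fun z => rfl
  have hgs : ∀ z, g (s z) = r z.2 := fun z => by rw [hsz, map_add, hgf, hgh, zero_add]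
  have hlift : ∀ n y, g n = r y → ∃ x, s (x, y) = n := by
    intro n y hy
    obtain ⟨a, ha⟩ := (hfg (n - h y)).1 (by rw [map_sub, hgh, hy, sub_self])
    obtain ⟨x, rfl⟩ := hp.surjective a
    exact ⟨x, by rw [hsz, ha, sub_add_cancel]⟩
  have hinl : ∀ x, p x = 0 ↔ s (x, 0) = 0 := fun x => by
    rw [hsz, map_zero, add_zero, map_eq_zero_iff f hf]
  have hmin : IsMinimalCover s := by
    refine ⟨fun n => ?_, fun z hz => ?_⟩
    · obtain ⟨y, hy⟩ := hr.surjective (g n)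
      obtain ⟨x, hx⟩ := hlift n y hy.symm
      exact ⟨_, hx⟩
    · have hz0 : s z = 0 := hz
      have h2 : z.2 ∈ maximalIdeal R • (⊤ : Submodule R F'') :=
        hr.ker_le (by rw [LinearMap.mem_ker, ← hgs, hz0, map_zero])
      -- Here `f (p z.1) = -h z.2` lies in `𝔪N`; without purity the horseshoe cover might fail to be
      -- minimal.
      refine Submodule.mem_smul_top_prod_iff.2 ⟨hp.mem_smul_top (hpure _ ?_), h2⟩
      rw [eq_neg_of_add_eq_zero_left ((hsz z).symm.trans hz0)]
      exact Submodule.neg_mem _ (Submodule.smul_top_le_comap_smul_top _ h h2)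
  have hinl_le : (LinearMap.ker p).map (LinearMap.inl R F' F'') ≤ LinearMap.ker s := by
    rintro _ ⟨x, hx, rfl⟩
    exact (hinl x).1 hx
  have hsnd_le : LinearMap.ker r ≤ (LinearMap.ker s).map (LinearMap.snd R F' F'') := by
    intro y hy
    obtain ⟨x, hx⟩ := hlift 0 y (by rw [map_zero]; exact (LinearMap.mem_ker.1 hy).symm)
    exact ⟨(x, y), hx, rfl⟩
  refine ⟨s, hmin, .extension (LinearMap.ker p) (LinearMap.ker s) (LinearMap.ker r)
    ((LinearMap.inl R F' F'').restrict fun x hx => (hinl x).1 hx)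
    ((LinearMap.snd R F' F'').restrict fun z hz => ?_) ?_ ?_ ?_ ?_ hpl.ker hrl.ker, ?_⟩
  · rw [LinearMap.mem_ker, LinearMap.snd_apply, ← hgs, LinearMap.mem_ker.1 hz, map_zero]
  · intro x y hxy
    exact Subtype.ext (congrArg (fun z => z.1.1) hxy)
  · rintro ⟨⟨x, y⟩, hz⟩
    constructor
    · intro hy
      obtain rfl : y = 0 := congrArg Subtype.val hy
      exact ⟨⟨x, (hinl x).2 hz⟩, rfl⟩
    · rintro ⟨x', hx'⟩
      exact Subtype.ext (congrArg (fun z => z.1.2) hx').symm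
  · rintro ⟨y, hy⟩
    obtain ⟨z, hz, rfl⟩ := hsnd_le hy
    exact ⟨⟨z, hz⟩, rfl⟩
  -- The kernel sequence is again pure: `(x, 0) ∈ 𝔪 ker s` forces `x ∈ ker p ∩ 𝔪²F' ⊆ 𝔪 ker p`.
  · rintro ⟨x, hx⟩ hxm
    rw [Submodule.mem_smul_top_iff] at hxm ⊢
    exact hpl.inf_le ⟨hx, (Submodule.mem_smul_top_prod_iff.1 (hmin.smul_ker_le hxm)).1⟩
  · rintro z ⟨hz, hz2⟩
    have hy : z.2 ∈ maximalIdeal R • LinearMap.ker r := hrl.inf_le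
      ⟨LinearMap.mem_ker.2 (by rw [← hgs, LinearMap.mem_ker.1 hz, map_zero]),
        (Submodule.mem_smul_top_prod_iff.1 hz2).2⟩
    -- Lift `z.2` to some `w ∈ 𝔪 ker s`; then `z - w` comes from `ker p ∩ 𝔪²F'`, where the property
    -- of `p` applies.
    have hy' := smul_mono_right _ hsnd_le hy
    rw [← Submodule.map_smul''] at hy'
    obtain ⟨w, hw, hwz⟩ := hy'
    have hd : z - w = LinearMap.inl R F' F'' (z.1 - w.1) := by
      ext
      · rfl
      · exact sub_eq_zero.2 hwz.symm
    have hker : z - w ∈ LinearMap.ker s := Submodule.sub_mem _ hz (Submodule.smul_le_right hw)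
    have hx : z.1 - w.1 ∈ maximalIdeal R • LinearMap.ker p := hpl.inf_le
      ⟨(hinl _).2 (by rw [hd] at hker; exact hker), (Submodule.mem_smul_top_prod_iff.1
        (Submodule.sub_mem _ hz2 (hmin.smul_ker_le hw))).1⟩
    rw [← sub_add_cancel z w, hd]
    refine Submodule.add_mem _ (smul_mono_right _ hinl_le ?_) hw
    rw [← Submodule.map_smul'']
    exact ⟨_, hx, rfl⟩

/-- The horseshoe provides one good minimal cover of an extension; uniqueness of minimal covers
carries the conclusion to `f`. -/
theorem IsIteratedPureExtension.isLinearCover [IsNoetherianRing R] {q : Ideal R}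
    (hm : maximalIdeal R ^ 2 = q * maximalIdeal R) (hq : q ^ 2 = ⊥)
    {N : Type u} [AddCommGroup N] [Module R N]
    (hN : IsIteratedPureExtension (maximalIdeal R) q N)
    {F : Type u} [AddCommGroup F] [Module R F] [Module.Finite R F] [Module.Projective R F]
    {f : F →ₗ[R] N} (hf : IsMinimalCover f) : IsLinearCover q f := by
  induction hN generalizing F with
  | of_annihilated N h => exact hf.isLinearCover_of_annihilated hm hq h
  | extension A N B i p hi hip hp hpure hA hB ihA ihB =>
    have := hA.finite
    have := hB.finite
    obtain ⟨a, f', hf', hk'⟩ := MinimalFreeResolution.exists_cover R A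
    obtain ⟨b, f'', hf'', hk''⟩ := MinimalFreeResolution.exists_cover R B
    obtain ⟨s, hs, hsl⟩ := exists_isLinearCover_of_extension hi hip hp hpure
      ⟨hf', hk'⟩ (ihA ⟨hf', hk'⟩) ⟨hf'', hk''⟩ (ihB ⟨hf'', hk''⟩)
    obtain ⟨e, he⟩ := hf.exists_equiv hs
    exact hsl.of_equiv e he

end LinearCovers

/-! ### Exactness of the linear part. -/

namespace MinimalFreeResolution

variable {R : Type u} [CommRing R] [IsLocalRing R] {M : Type v} [AddCommGroup M] [Module R M]
  (F : MinimalFreeResolution R M)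

theorem isMinimalCover_ε : IsMinimalCover F.ε :=
  ⟨F.surjective_ε, (LinearMap.exact_iff.1 F.exact_ε).le.trans (F.minimal 0)⟩

theorem ker_d (i : ℕ) : LinearMap.ker (F.d i) = LinearMap.range (F.d (i + 1)) :=
  LinearMap.exact_iff.1 (F.exact_d i)

theorem isMinimalCover_rangeRestrict (i : ℕ) : IsMinimalCover (F.d i).rangeRestrict :=
  ⟨LinearMap.surjective_rangeRestrict _, by
    rw [LinearMap.ker_rangeRestrict, F.ker_d]
    exact F.minimal (i + 1)⟩

theorem range_d_inf_le [IsNoetherianRing R] {q : Ideal R}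
    (hm : maximalIdeal R ^ 2 = q * maximalIdeal R) (hq : q ^ 2 = ⊥)
    (hM : ∀ r ∈ q, ∀ x : M, r • x = 0) (i : ℕ) :
    LinearMap.range (F.d i) ⊓ maximalIdeal R ^ 2 • (⊤ : Submodule R (Fin (F.rank i) → R)) ≤
      maximalIdeal R • LinearMap.range (F.d i) := by
  -- The induction must also carry the structure of the syzygy, since syzygies need not be killed by
  -- `q`.
  have key : ∀ i, IsIteratedPureExtension (maximalIdeal R) q (LinearMap.range (F.d i)) ∧
      LinearMap.range (F.d i) ⊓ maximalIdeal R ^ 2 • (⊤ : Submodule R (Fin (F.rank i) → R)) ≤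
        maximalIdeal R • LinearMap.range (F.d i) := by
    intro i
    induction i with
    | zero =>
      have h := F.isMinimalCover_ε.isLinearCover_of_annihilated hm hq hM
      rw [← LinearMap.exact_iff.1 F.exact_ε]
      exact ⟨h.ker, h.inf_le⟩
    | succ i ih =>
      have h := ih.1.isLinearCover hm hq (F.isMinimalCover_rangeRestrict i)
      have h1 := h.ker
      have h2 := h.inf_le
      rw [LinearMap.ker_rangeRestrict, F.ker_d] at h1 h2
      exact ⟨h1, h2⟩
  exact (key i).2

theorem mem_smul_top_of_d_mem
    {i : ℕ} (h : LinearMap.range (F.d i) ⊓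
      maximalIdeal R ^ 2 • (⊤ : Submodule R (Fin (F.rank i) → R)) ≤
        maximalIdeal R • LinearMap.range (F.d i))
    {x : Fin (F.rank (i + 1)) → R}
    (hx : F.d i x ∈ maximalIdeal R ^ 2 • (⊤ : Submodule R (Fin (F.rank i) → R))) :
    x ∈ maximalIdeal R • (⊤ : Submodule R (Fin (F.rank (i + 1)) → R)) := by
  have h' := h ⟨⟨x, rfl⟩, hx⟩
  rw [← Submodule.map_top, ← Submodule.map_smul''] at h'
  obtain ⟨y, hy, hyx⟩ := h'
  rw [← sub_add_cancel x y]
  refine Submodule.add_mem _ (F.minimal (i + 1) ?_) hy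
  rw [← F.ker_d, LinearMap.mem_ker, map_sub, hyx, sub_self]

/-- The elementwise form of the exactness of the linear part in positive degrees. -/
theorem exists_filtration_lift (h3 : maximalIdeal R ^ 3 = ⊥)
    (h : ∀ i, LinearMap.range (F.d i) ⊓
      maximalIdeal R ^ 2 • (⊤ : Submodule R (Fin (F.rank i) → R)) ≤
        maximalIdeal R • LinearMap.range (F.d i))
    {n i : ℕ} {x : Fin (F.rank (i + 1)) → R} (hx : x ∈ F.filtration n (i + 1))
    (hdx : F.d i x ∈ F.filtration (n + 1) i) :
    ∃ y ∈ F.filtration n (i + 2), F.d (i + 1) y - x ∈ F.filtration (n + 1) (i + 1) := by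
  unfold filtration at hx hdx ⊢
  have hlift : F.d i x = 0 → ∃ y, F.d (i + 1) y = x := fun h0 => (F.exact_d i x).1 h0
  rcases Nat.lt_or_ge n (i + 1) with hn | hn
  · refine ⟨0, Submodule.zero_mem _, ?_⟩
    rw [show n + 1 - (i + 1) = 0 by omega, pow_zero, Ideal.one_eq_top, Submodule.top_smul]
    exact Submodule.mem_top
  -- Now `x ∈ 𝔪^p F` and `d x ∈ 𝔪^(p+2) F`. For `p = 0` the key property puts `x` in `𝔪F`; for `p ≥
  -- 1`, `𝔪³ = 0` makes `x` a cycle.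
  obtain ⟨p, rfl⟩ := Nat.exists_eq_add_of_le hn
  rw [show i + 1 + p + 1 - (i + 1) = p + 1 by omega]
  rw [show i + 1 + p + 1 - i = p + 2 by omega] at hdx
  rw [show i + 1 + p - (i + 1) = p by omega] at hx
  rcases Nat.eq_zero_or_pos p with rfl | hp
  · refine ⟨0, Submodule.zero_mem _, ?_⟩
    rw [map_zero, zero_sub, zero_add, pow_one]
    exact Submodule.neg_mem _ (F.mem_smul_top_of_d_mem (h i) hdx)
  have hzero : ∀ {k j : ℕ}, 3 ≤ k → ∀ z : Fin (F.rank j) → R,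
      z ∈ maximalIdeal R ^ k • (⊤ : Submodule R (Fin (F.rank j) → R)) → z = 0 := by
    intro k j hk z hz
    have hk0 : maximalIdeal R ^ k = ⊥ := le_bot_iff.1 ((Ideal.pow_le_pow_right hk).trans h3.le)
    rwa [hk0, Submodule.bot_smul, Submodule.mem_bot] at hz
  obtain ⟨y, rfl⟩ := hlift (hzero (by omega) _ hdx)
  rcases Nat.lt_or_ge p 3 with hp3 | hp3
  · refine ⟨y, ?_, by rw [sub_self]; exact Submodule.zero_mem _⟩
    obtain rfl | rfl : p = 1 ∨ p = 2 := by omega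
    · rw [show i + 1 + 1 - (i + 2) = 0 by omega, pow_zero, Ideal.one_eq_top, Submodule.top_smul]
      exact Submodule.mem_top
    -- The boundary `x = d y` lies in `𝔪²F`, so the key property one degree up puts `y` in `𝔪F`.
    · rw [show i + 1 + 2 - (i + 2) = 1 by omega, pow_one]
      exact F.mem_smul_top_of_d_mem (h (i + 1)) hx
  · exact ⟨0, Submodule.zero_mem _, by
      rw [hzero hp3 _ hx, map_zero, sub_zero]; exact Submodule.zero_mem _⟩

theorem exact_grD (h3 : maximalIdeal R ^ 3 = ⊥)
    (h : ∀ i, LinearMap.range (F.d i) ⊓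
      maximalIdeal R ^ 2 • (⊤ : Submodule R (Fin (F.rank i) → R)) ≤
        maximalIdeal R • LinearMap.range (F.d i)) (n i : ℕ) :
    LinearMap.ker (F.grD n i) ≤ LinearMap.range (F.grD n (i + 1)) := by
  intro x hx
  obtain ⟨x, rfl⟩ := Submodule.Quotient.mk_surjective _ x
  have hdx : F.d i x.1 ∈ F.filtration (n + 1) i :=
    (Submodule.Quotient.mk_eq_zero ((F.filtration (n + 1) i).submoduleOf (F.filtration n i))).1
      (LinearMap.mem_ker.1 hx)
  obtain ⟨y, hy, hyx⟩ := F.exists_filtration_lift h3 h x.2 hdx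
  exact ⟨Submodule.Quotient.mk ⟨y, hy⟩, (Submodule.Quotient.eq _).2 hyx⟩

theorem isZero_linearPart_homology
    (h : ∀ n i, LinearMap.ker (F.grD n i) ≤ LinearMap.range (F.grD n (i + 1))) (i : ℕ) :
    Limits.IsZero (F.linearPart.homology (i + 1)) := by
  rw [← HomologicalComplex.exactAt_iff_isZero_homology,
    HomologicalComplex.exactAt_iff' _ (i + 2) (i + 1) i (by simp) (by simp),
    ShortComplex.moduleCat_exact_iff_ker_sub_range]
  have hd : ∀ j, F.linearPart.d (j + 1) j =
      ModuleCat.ofHom (DirectSum.lmap (fun n => F.grD n j)) := fun j =>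
    ChainComplex.of_d (fun i => ModuleCat.of R (DirectSum ℕ fun n => F.gr n i))
      (fun i => ModuleCat.ofHom (DirectSum.lmap fun n => F.grD n i)) j
  change LinearMap.ker (F.linearPart.d (i + 1) i).hom ≤
    LinearMap.range (F.linearPart.d (i + 1 + 1) (i + 1)).hom
  rw [hd, hd]
  change LinearMap.ker (DirectSum.lmap (fun n => F.grD n i)) ≤
    LinearMap.range (DirectSum.lmap (fun n => F.grD n (i + 1)))
  rw [DirectSum.ker_lmap, DirectSum.range_lmap]
  exact Submodule.comap_mono (Submodule.pi_mono fun n _ => h n i)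

end MinimalFreeResolution

theorem isKoszulModule_of_smul_top_eq_bot {R : Type u} [CommRing R] [IsLocalRing R]
    [IsNoetherianRing R] {q : Ideal R} (hm : maximalIdeal R ^ 2 = q * maximalIdeal R)
    (hq : q ^ 2 = ⊥) (M : Type v) [AddCommGroup M] [Module R M] [Module.Finite R M]
    (hM : q • (⊤ : Submodule R M) = ⊥) : IsKoszulModule R M := by
  have hM' : ∀ r ∈ q, ∀ x : M, r • x = 0 := fun r hr x =>
    (Submodule.mem_bot R).1 (hM ▸ Submodule.smul_mem_smul hr Submodule.mem_top)
  refine le_antisymm (iSup_le fun F => sSup_le ?_) bot_le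
  rintro _ ⟨i, rfl, hi⟩
  cases i with
  -- Homology in degree `0` may be nonzero, but contributes only the value `0`.
  | zero => simp
  | succ i =>
    exact absurd (F.isZero_linearPart_homology (F.exact_grD (maximalIdeal_pow_three_eq_bot hm hq)
      (F.range_d_inf_le hm hq hM')) i) hi

theorem proposition5p12 {R : Type u} [CommRing R] [IsLocalRing R] [IsNoetherianRing R]
    (q : Ideal R) (hqm : q ≤ maximalIdeal R)
    (hm : maximalIdeal R ^ 2 = q * maximalIdeal R) (hq : q ^ 2 = ⊥) :
    (∀ (e : ℕ) (y : Fin e → R), IsMinimalGeneratingFamily q y →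
      IsKoszulFiltration (chainAndIdealsContaining q y)) ∧
    ∀ (M : Type v) [AddCommGroup M] [Module R M] [Module.Finite R M],
      q • (⊤ : Submodule R M) = ⊥ → IsKoszulModule R M :=
  ⟨fun _ _ hy => hy.isKoszulFiltration hqm hm hq,
    fun M _ _ _ hM => isKoszulModule_of_smul_top_eq_bot hm hq M hM⟩
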